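/- All groups are abelian. A precompact group topology on a group is a Hausdorff group topology that is totally bounded (for every neighbourhood $U$ of $0$, finitely many translates of $U$ cover the group). A sequence $\mathbf u=(u_n)_{n\in\mathbb N}$ in an abelian group $G$ is called a $TB$-sequence in $G$ if $u_n\to 0$ in some precompact group topology on $G$; in that case $\tau_{\mathbf u}$ denotes the finest precompact group topology on $G$ in which $u_n\to 0$. If $H$ is a subgroup of $G$ and $\zeta$ is a precompact group topology on $H$, the finest precompact extension of $\zeta$ to $G$ is a precompact group topology $\tau^*$ on $G$ such that $\tau^*|_H=\zeta$ and such that $\tau'\le\tau^*$ (that is, $\tau^*$ is finer than $\tau'$) for every precompact group topology $\tau'$ on $G$ with $\tau'|_H=\zeta$. **Proposition 1.5.** Let $\mathbf u$ be a $TB$-sequence in an abelian group $G$ and let $H$ be any subgroup of $G$ containing the subgroup $\langle\mathbf u\rangle$ generated by $\mathbf u$. Then $\mathbf u$ is also a $TB$-sequence in $H$; let $\tau_{\mathbf u}(H)$ denote the finest precompact group topology on $H$ in which $u_n\to 0$. Then $\tau_{\mathbf u}$ is the finest precompact extension of $\tau_{\mathbf u}(H)$ to $G$. In particular, $\tau_{\mathbf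 u}|_H=\tau_{\mathbf u}(H)$. -/

import Mathlib

open Filter Topology

/-- A topology `t` on an abelian group `G` is a precompact group topology: a Hausdorff group topology
which is totally bounded, i.e. for every neighbourhood `U` of `0`, the group is covered by finitely
many translates of `U`. -/
structure IsPrecompactTopology {G : Type*} [AddCommGroup G] (t : TopologicalSpace G) : Prop where
  isTopologicalAddGroup : @IsTopologicalAddGroup G t _
  t2Space : @T2Space G t
  totallyBounded : ∀ U ∈ @nhds G t 0, ∃ F : Finset G, ∀ x : G, ∃ a ∈ F, x - a ∈ U

/-- The set of all precompact group topologies on `G` in which the sequence `u` converges to `0`. -/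
def precompactTopologiesConverging {G : Type*} [AddCommGroup G] (u : ℕ → G) :
    Set (TopologicalSpace G) :=
  {t | IsPrecompactTopology t ∧ Tendsto u atTop (@nhds G t 0)}

/-- `u` is a `TB`-sequence: it converges to `0` in some precompact group topology on `G`. -/
def IsTBSequence {G : Type*} [AddCommGroup G] (u : ℕ → G) : Prop :=
  (precompactTopologiesConverging u).Nonempty

/-- The topology generated by all precompact group topologies on `G` in which `u` converges to `0`.
In Mathlib's order on topologies `t ≤ s` means that `t` is finer than `s`, so this is an infimum.
When `u` is a `TB`-sequence it is the finest precompact group topology in which `u` converges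
to `0`, see `isLeast_tauSeq`. -/
@[reducible] def tauSeq {G : Type*} [AddCommGroup G] (u : ℕ → G) : TopologicalSpace G :=
  sInf (precompactTopologiesConverging u)

/-- A sequence of `G`, regarded as a sequence in a subgroup containing all its terms. -/
def seqInSubgroup {G : Type*} [AddCommGroup G] (u : ℕ → G) (H : AddSubgroup G)
    (hH : AddSubgroup.closure (Set.range u) ≤ H) : ℕ → H :=
  fun n => ⟨u n, hH (AddSubgroup.subset_closure (Set.mem_range_self n))⟩

/-- `τ` is the finest precompact extension to `G` of the precompact group topology `ζ` on `H`:
both are precompact group topologies, `τ` induces `ζ` on `H`, and `τ` is finer than every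
precompact group topology on `G` that induces `ζ` on `H`. -/
structure IsFinestPrecompactExtension {G : Type*} [AddCommGroup G] (H : AddSubgroup G)
    (ζ : TopologicalSpace H) (τ : TopologicalSpace G) : Prop where
  precompact_base : IsPrecompactTopology ζ
  precompact : IsPrecompactTopology τ
  restrict_eq : TopologicalSpace.induced (Subtype.val : H → G) τ = ζ
  finest : ∀ τ' : TopologicalSpace G, IsPrecompactTopology τ' →
    TopologicalSpace.induced (Subtype.val : H → G) τ' = ζ → τ ≤ τ'

/-- Auxiliary filter: sets `U` such that `G` has a finite partition into pieces whose difference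
sets lie in `U`. -/
def smallPartitionFilter (G : Type*) [AddCommGroup G] : Filter G where
  sets := {U | ∃ (k : Type) (_ : Finite k) (c : G → k), ∀ x y, c x = c y → x - y ∈ U}
  univ_sets := ⟨Unit, inferInstance, fun _ => (), fun _ _ _ => trivial⟩
  sets_of_superset := by
    rintro U V ⟨k, hk, c, hc⟩ hUV
    exact ⟨k, hk, c, fun x y h => hUV (hc x y h)⟩
  inter_sets := by
    rintro U V ⟨k, hk, c, hc⟩ ⟨l, hl, d, hd⟩
    refine ⟨k × l, inferInstance, fun x => (c x, d x), fun x y h => ?_⟩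
    exact ⟨hc x y (congrArg Prod.fst h), hd x y (congrArg Prod.snd h)⟩

theorem exists_finset_of_mem_smallPartitionFilter {G : Type*} [AddCommGroup G] {U : Set G}
    (hU : U ∈ smallPartitionFilter G) : ∃ F : Finset G, ∀ x : G, ∃ a ∈ F, x - a ∈ U := by
  classical
  obtain ⟨k, hk, c, hc⟩ := hU
  have := Fintype.ofFinite k
  refine ⟨Finset.univ.image fun i : k => if h : ∃ x, c x = i then h.choose else 0, fun x => ?_⟩
  have h : ∃ y, c y = c x := ⟨x, rfl⟩
  refine ⟨h.choose, Finset.mem_image.2 ⟨c x, Finset.mem_univ _, by rw [dif_pos h]⟩, ?_⟩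
  exact hc _ _ h.choose_spec.symm

theorem IsPrecompactTopology.smallPartitionFilter_le {G : Type*} [AddCommGroup G]
    {t : TopologicalSpace G} (ht : IsPrecompactTopology t) :
    smallPartitionFilter G ≤ @nhds G t 0 := by
  intro U hU
  have := ht.isTopologicalAddGroup
  have hc : Tendsto (fun p : G × G => p.1 - p.2) (𝓝 0 ×ˢ 𝓝 0) (𝓝 (0 : G)) := by
    have h : ContinuousAt (fun p : G × G => p.1 - p.2) (0, 0) :=
      (continuous_fst.sub continuous_snd).continuousAt
    simpa [ContinuousAt, nhds_prod_eq] using h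
  obtain ⟨V, hV, hVU⟩ := mem_prod_same_iff.1 (hc hU)
  obtain ⟨F, hF⟩ := ht.totallyBounded V hV
  choose a haF haV using hF
  refine ⟨Fin F.card, inferInstance, fun x => F.equivFin ⟨a x, haF x⟩, fun x y h => ?_⟩
  have h' : a x = a y := congrArg Subtype.val (F.equivFin.injective h)
  have h2 : (x - a x) - (y - a y) ∈ U :=
    hVU (show (x - a x, y - a y) ∈ V ×ˢ V from ⟨haV x, haV y⟩)
  simpa [h'] using h2

/-- For a `TB`-sequence `u`, the topology `tauSeq u` is the finest precompact group topology in
which `u` converges to `0`. -/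
theorem isLeast_tauSeq {G : Type*} [AddCommGroup G] {u : ℕ → G} (hu : IsTBSequence u) :
    IsLeast (precompactTopologiesConverging u) (tauSeq u) := by
  refine ⟨⟨⟨?_, ?_, ?_⟩, ?_⟩, fun t ht => sInf_le ht⟩
  · exact topologicalAddGroup_sInf fun t ht => ht.1.isTopologicalAddGroup
  · obtain ⟨t, ht⟩ := hu
    exact t2Space_antitone (sInf_le ht) ht.1.t2Space
  · intro U hU
    refine exists_finset_of_mem_smallPartitionFilter ?_
    rw [tauSeq, nhds_sInf] at hU
    exact (le_iInf₂ fun t (ht : t ∈ precompactTopologiesConverging u) =>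
      ht.1.smallPartitionFilter_le) hU
  · rw [tauSeq, nhds_sInf]
    exact tendsto_iInf.2 fun t => tendsto_iInf.2 fun ht => ht.2

/-- A `TB`-sequence in `G` is a `TB`-sequence in every subgroup containing its terms. -/
theorem IsTBSequence.seqInSubgroup {G : Type*} [AddCommGroup G] {u : ℕ → G} (hu : IsTBSequence u)
    (H : AddSubgroup G) (hH : AddSubgroup.closure (Set.range u) ≤ H) :
    IsTBSequence (seqInSubgroup u H hH) := by
  obtain ⟨t, ht, hlim⟩ := hu
  have h1 := ht.isTopologicalAddGroup
  have h2 := ht.t2Space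
  refine ⟨TopologicalSpace.induced Subtype.val t,
    ⟨inferInstanceAs (IsTopologicalAddGroup H), inferInstanceAs (T2Space H), ?_⟩, ?_⟩
  · intro U hU
    rw [nhds_induced] at hU
    obtain ⟨V, hV, hVU⟩ := hU
    obtain ⟨k, hk, c, hc⟩ := ht.smallPartitionFilter_le hV
    exact exists_finset_of_mem_smallPartitionFilter
      ⟨k, hk, fun x => c x, fun x y h => hVU (hc x y h)⟩
  · rw [nhds_induced]
    exact tendsto_comap_iff.2 hlim

/-! Restricting `tauSeq u` to `H` gives a precompact topology in which the sequence tends to `0`, so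
the topology of `H` is finer than this restriction. The converse rests on duality: a precompact
topology is generated by its continuous characters. A character of `H` continuous for the topology
of `H` sends the sequence to `0`. It extends to `G` because the circle is divisible, and the
extension has the same values on the sequence. Adjoining the extension to a witnessing topology
keeps precompactness and convergence, so the extension is continuous for `tauSeq u`
(`exists_extension_tauSeq_le`). Maximality is formal: any extension of the topology of `H` makes the
sequence converge.

Duality (`IsPrecompactTopology.exists_characters`) is proved without Haar measure. A neighbourhood
of `0` contains a ball of a continuous, totally bounded seminorm. The group is approximated by
finite abelian groups, where Bogolyubov's lemma supplies characters, their number bounded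
independently of the approximation. An ultrafilter limit turns these approximate characters into
genuine ones. -/

/-! ### Fourier analysis on finite abelian groups. -/

section FiniteFourier

open Finset

variable {A : Type*} [AddCommGroup A] [Fintype A]

/-- The normalized Fourier coefficient of a real function at a character. -/
noncomputable def expectCoeff (f : A → ℝ) (χ : AddChar A ℂ) : ℂ :=
  (∑ y, (f y : ℂ) * χ y) / Fintype.card A

theorem star_expectCoeff (f : A → ℝ) (χ : AddChar A ℂ) :
    star (expectCoeff f χ) = (∑ y, (f y : ℂ) * χ (-y)) / Fintype.card A := by
  simp [expectCoeff, AddChar.map_neg_eq_conj]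

/-- By orthogonality of characters the sum equals the mean of `f ^ 2` (Parseval). -/
theorem sum_norm_expectCoeff_sq_le (f : A → ℝ) (h0 : ∀ y, 0 ≤ f y) (h1 : ∀ y, f y ≤ 1) :
    ∑ χ : AddChar A ℂ, ‖expectCoeff f χ‖ ^ 2 ≤ 1 := by
  classical
  have hA : (0 : ℝ) < Fintype.card A := by exact_mod_cast Fintype.card_pos
  have key : ((∑ χ : AddChar A ℂ, ‖expectCoeff f χ‖ ^ 2 : ℝ) : ℂ) =
      ((∑ y, f y ^ 2) / Fintype.card A : ℝ) := by
    push_cast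
    have h : ∀ χ : AddChar A ℂ, ((‖expectCoeff f χ‖ : ℂ)) ^ 2 =
        ∑ y, ∑ z, (f y : ℂ) * f z * χ (y - z) / (Fintype.card A : ℂ) ^ 2 := by
      intro χ
      rw [← Complex.mul_conj', ← Complex.star_def, star_expectCoeff, expectCoeff,
        div_mul_div_comm, sum_mul_sum, ← sq, sum_div]
      refine sum_congr rfl fun y _ => ?_
      rw [sum_div]
      refine sum_congr rfl fun z _ => ?_
      rw [sub_eq_add_neg, AddChar.map_add_eq_mul]
      ring
    simp_rw [h]
    rw [sum_comm, sum_div]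
    refine sum_congr rfl fun y _ => ?_
    rw [sum_comm]
    simp_rw [← sum_div, ← mul_sum, AddChar.sum_apply_eq_ite, sub_eq_zero]
    have hA' : (Fintype.card A : ℂ) ≠ 0 := by exact_mod_cast hA.ne'
    simp
    field_simp
  rw [Complex.ofReal_inj] at key
  rw [key, div_le_one hA]
  calc ∑ y, f y ^ 2 ≤ ∑ _y : A, (1 : ℝ) :=
        sum_le_sum fun y _ => pow_le_one₀ (h0 y) (h1 y)
    _ = _ := by simp

/-- Up to a positive factor, the sum is the value at `x` of the fourfold convolution of `f`,
reflected `f`, `f`, reflected `f`. -/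
theorem exists_of_sum_norm_expectCoeff_ne_zero (f : A → ℝ) (x : A)
    (h : ∑ χ : AddChar A ℂ, (‖expectCoeff f χ‖ : ℂ) ^ 4 * χ x ≠ 0) :
    ∃ a b c d, f a ≠ 0 ∧ f b ≠ 0 ∧ f c ≠ 0 ∧ f d ≠ 0 ∧ x = a - b + c - d := by
  classical
  by_contra! hne
  refine h ?_
  have h4 : ∀ χ : AddChar A ℂ, (‖expectCoeff f χ‖ : ℂ) ^ 4 * χ x =
      ∑ a, ∑ b, ∑ c, ∑ d, (f a : ℂ) * f b * f c * f d / (Fintype.card A : ℂ) ^ 4 *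
        χ (x - (a - b + c - d)) := by
    intro χ
    rw [show (‖expectCoeff f χ‖ : ℂ) ^ 4 = ((‖expectCoeff f χ‖ : ℂ) ^ 2) *
      ((‖expectCoeff f χ‖ : ℂ) ^ 2) by ring, ← Complex.conj_mul', ← Complex.star_def,
      star_expectCoeff, expectCoeff, div_mul_div_comm, div_mul_div_comm, mul_assoc, sum_mul,
      sum_div, sum_mul]
    refine sum_congr rfl fun a _ => ?_
    rw [sum_mul, mul_sum, sum_div, sum_mul]
    refine sum_congr rfl fun b _ => ?_
    rw [sum_mul, mul_sum, mul_sum, sum_div, sum_mul]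
    refine sum_congr rfl fun c _ => ?_
    rw [mul_sum, mul_sum, mul_sum, sum_div, sum_mul]
    refine sum_congr rfl fun d _ => ?_
    rw [show x - (a - b + c - d) = -a + b + -c + d + x by abel]
    simp only [AddChar.map_add_eq_mul]
    ring
  simp_rw [h4]
  rw [sum_comm]
  refine sum_eq_zero fun a _ => ?_
  rw [sum_comm]
  refine sum_eq_zero fun b _ => ?_
  rw [sum_comm]
  refine sum_eq_zero fun c _ => ?_
  rw [sum_comm]
  refine sum_eq_zero fun d _ => ?_
  rw [← mul_sum, AddChar.sum_apply_eq_ite]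
  split_ifs with hx
  · have := hne a b c d
    by_cases ha : f a = 0
    · simp [ha]
    by_cases hb : f b = 0
    · simp [hb]
    by_cases hc : f c = 0
    · simp [hc]
    by_cases hd : f d = 0
    · simp [hd]
    exact absurd (sub_eq_zero.1 hx) (this ha hb hc hd)
  · simp

/-- Translating `f` by `t` multiplies its coefficient by `χ t`. Hence a character with a large
coefficient inherits the modulus of continuity of `f`. -/
theorem norm_expectCoeff_mul_norm_sub_one_le (f : A → ℝ) (χ : AddChar A ℂ) (t : A) (η : ℝ)
    (h : ∀ y, |f (y - t) - f y| ≤ η) : ‖expectCoeff f χ‖ * ‖χ t - 1‖ ≤ η := by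
  have hA : (0 : ℝ) < Fintype.card A := by exact_mod_cast Fintype.card_pos
  have hshift : ∑ y, (f y : ℂ) * χ y * χ t = ∑ y, (f (y - t) : ℂ) * χ y := by
    rw [← Equiv.sum_comp (Equiv.subRight t) fun y => (f y : ℂ) * χ y * χ t]
    refine sum_congr rfl fun y _ => ?_
    rw [Equiv.subRight_apply, mul_assoc, ← AddChar.map_add_eq_mul, sub_add_cancel]
  have heq : expectCoeff f χ * (χ t - 1) =
      (∑ y, ((f (y - t) - f y : ℝ) : ℂ) * χ y) / Fintype.card A := by
    rw [expectCoeff, div_mul_eq_mul_div, mul_sub, sum_mul, hshift, mul_one, ← sum_sub_distrib]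
    push_cast
    simp_rw [sub_mul]
  rw [← norm_mul, heq, norm_div, Complex.norm_natCast, div_le_iff₀ hA]
  calc _ ≤ ∑ y, ‖((f (y - t) - f y : ℝ) : ℂ) * χ y‖ := norm_sum_le _ _
    _ ≤ ∑ _y : A, η := sum_le_sum fun y _ => by
        rw [norm_mul, AddChar.norm_apply, mul_one, Complex.norm_real]
        exact h y
    _ = _ := by simp [mul_comm]

/-- A quantitative Bogolyubov lemma: the number of characters depends only on the mean of `f`. -/
theorem exists_addChar_bogolyubov (f : A → ℝ) (h0 : ∀ y, 0 ≤ f y) (h1 : ∀ y, f y ≤ 1)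
    {β : ℝ} (hβ : 0 < β) (hf : β ≤ (∑ y, f y) / Fintype.card A) {m : ℕ} (hm : 4 / β ^ 4 ≤ m) :
    ∃ χ : Fin m → AddChar A ℂ,
      (∀ i t η, (∀ y, |f (y - t) - f y| ≤ η) → β ^ 2 / 2 * ‖χ i t - 1‖ ≤ η) ∧
      ∀ x, (∀ i, 0 ≤ (χ i x).re) →
        ∃ a b c d, f a ≠ 0 ∧ f b ≠ 0 ∧ f c ≠ 0 ∧ f d ≠ 0 ∧ x = a - b + c - d := by
  classical
  have hA : (0 : ℝ) < Fintype.card A := by exact_mod_cast Fintype.card_pos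
  have hβ1 : β ≤ 1 := hf.trans <| by
    rw [div_le_one hA]
    calc _ ≤ ∑ _y : A, (1 : ℝ) := sum_le_sum fun y _ => h1 y
      _ = _ := by simp
  -- Threshold for the large spectrum `S`: Parseval gives at most `1 / δ ^ 2 = 4 / β ^ 4`
  -- characters, while the others contribute at most `δ ^ 2 < β ^ 4`, less than the trivial
  -- character.
  set δ := β ^ 2 / 2 with hδ
  have hδ0 : 0 < δ := by positivity
  have hpars := sum_norm_expectCoeff_sq_le f h0 h1
  set S : Finset (AddChar A ℂ) := univ.filter fun χ => δ ≤ ‖expectCoeff f χ‖ with hS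
  have hone : β ≤ ‖expectCoeff f 0‖ := by
    have : expectCoeff f 0 = (((∑ y, f y) / Fintype.card A : ℝ) : ℂ) := by
      simp [expectCoeff]
    rw [this, Complex.norm_real]
    exact hf.trans (le_abs_self _)
  have h0S : (0 : AddChar A ℂ) ∈ S := by
    refine mem_filter.2 ⟨mem_univ _, le_trans ?_ hone⟩
    nlinarith
  have hcard : S.card ≤ m := by
    have h2 : (S.card : ℝ) * δ ^ 2 ≤ 1 := by
      calc (S.card : ℝ) * δ ^ 2 = ∑ _χ ∈ S, δ ^ 2 := by simp
        _ ≤ ∑ χ ∈ S, ‖expectCoeff f χ‖ ^ 2 := sum_le_sum fun χ hχ =>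
            pow_le_pow_left₀ hδ0.le (mem_filter.1 hχ).2 2
        _ ≤ ∑ χ, ‖expectCoeff f χ‖ ^ 2 :=
            sum_le_sum_of_subset_of_nonneg (subset_univ _) fun _ _ _ => by positivity
        _ ≤ 1 := hpars
    have h3 : (S.card : ℝ) ≤ 4 / β ^ 4 := by
      rw [le_div_iff₀ (by positivity)]
      rw [hδ] at h2
      nlinarith
    exact_mod_cast h3.trans hm
  have hlarge : ∀ χ ∈ S, δ ≤ ‖expectCoeff f χ‖ := fun χ hχ => (mem_filter.1 hχ).2
  -- The trivial character, itself in `S`, pads the family to length `m`.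
  refine ⟨fun i => if h : (i : ℕ) < S.card then S.equivFin.symm ⟨i, h⟩ else 0, ?_, ?_⟩
  · intro i t η h
    have hmem : (if h : (i : ℕ) < S.card then (S.equivFin.symm ⟨i, h⟩ : AddChar A ℂ) else 0) ∈ S := by
      split_ifs
      · exact Subtype.coe_prop _
      · exact h0S
    exact (mul_le_mul_of_nonneg_right (hlarge _ hmem) (norm_nonneg _)).trans
      (norm_expectCoeff_mul_norm_sub_one_le f _ t η h)
  · intro x hx
    have hxS : ∀ χ ∈ S, 0 ≤ (χ x).re := by
      intro χ hχ
      have hlt := (S.equivFin ⟨χ, hχ⟩).2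
      have := hx ⟨S.equivFin ⟨χ, hχ⟩, hlt.trans_le hcard⟩
      simpa [hlt] using this
    refine exists_of_sum_norm_expectCoeff_ne_zero f x fun hzero => ?_
    have hre : ∑ χ : AddChar A ℂ, ‖expectCoeff f χ‖ ^ 4 * (χ x).re = 0 := by
      have := congrArg Complex.re hzero
      rw [Complex.re_sum] at this
      rw [Complex.zero_re] at this
      rw [← this]
      refine sum_congr rfl fun χ _ => ?_
      rw [← Complex.ofReal_pow, Complex.re_ofReal_mul]
    have hlow : ∀ χ ∈ univ.erase (0 : AddChar A ℂ),
        -(δ ^ 2 * ‖expectCoeff f χ‖ ^ 2) ≤ ‖expectCoeff f χ‖ ^ 4 * (χ x).re := by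
      intro χ _
      by_cases hχ : χ ∈ S
      · have : 0 ≤ ‖expectCoeff f χ‖ ^ 4 * (χ x).re := mul_nonneg (by positivity) (hxS χ hχ)
        have : 0 ≤ δ ^ 2 * ‖expectCoeff f χ‖ ^ 2 := by positivity
        linarith
      · have hsm : ‖expectCoeff f χ‖ ≤ δ := by
          by_contra! hc
          exact hχ (mem_filter.2 ⟨mem_univ _, hc.le⟩)
        have hr : -1 ≤ (χ x).re := by
          have := Complex.abs_re_le_norm (χ x)
          rw [AddChar.norm_apply] at this
          exact (abs_le.1 this).1
        have hsq : ‖expectCoeff f χ‖ ^ 2 ≤ δ ^ 2 := pow_le_pow_left₀ (norm_nonneg _) hsm 2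
        have h5 : ‖expectCoeff f χ‖ ^ 4 ≤ δ ^ 2 * ‖expectCoeff f χ‖ ^ 2 := by
          calc _ = ‖expectCoeff f χ‖ ^ 2 * ‖expectCoeff f χ‖ ^ 2 := by ring
            _ ≤ _ := mul_le_mul_of_nonneg_right hsq (by positivity)
        have : 0 ≤ ‖expectCoeff f χ‖ ^ 4 := by positivity
        nlinarith
    rw [← add_sum_erase univ _ (mem_univ (0 : AddChar A ℂ))] at hre
    have h6 := sum_le_sum hlow
    rw [sum_neg_distrib, ← mul_sum] at h6
    have h7 : ∑ χ ∈ univ.erase (0 : AddChar A ℂ), ‖expectCoeff f χ‖ ^ 2 ≤ 1 :=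
      (sum_le_sum_of_subset_of_nonneg (subset_univ _) fun _ _ _ => by positivity).trans hpars
    have h8 : β ^ 4 ≤ ‖expectCoeff f 0‖ ^ 4 := pow_le_pow_left₀ hβ.le hone 4
    have h9 : δ ^ 2 * ∑ χ ∈ univ.erase (0 : AddChar A ℂ), ‖expectCoeff f χ‖ ^ 2 ≤ δ ^ 2 :=
      mul_le_of_le_one_right (by positivity) h7
    have h10 : δ ^ 2 < β ^ 4 := by
      rw [hδ]
      have : 0 < β ^ 4 := by positivity
      nlinarith
    simp only [AddChar.zero_apply, Complex.one_re, mul_one] at hre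
    linarith

end FiniteFourier

/-! ### Totally bounded seminorms and their characters. -/

/-- A seminorm on a group whose balls finitely cover the group by translation. -/
def AddGroupSeminorm.IsTotallyBounded {H : Type*} [AddCommGroup H] (q : AddGroupSeminorm H) :
    Prop :=
  ∀ ε > 0, ∃ F : Finset H, ∀ x, ∃ a ∈ F, q (x - a) ≤ ε

theorem AddGroupSeminorm.sum_le {H ι : Type*} [AddCommGroup H] (q : AddGroupSeminorm H)
    (s : Finset ι) (v : ι → H) : q (∑ i ∈ s, v i) ≤ ∑ i ∈ s, q (v i) :=
  Finset.le_sum_of_subadditive q (map_zero q).le (map_add_le_add q) s v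

/-- Simultaneous recurrence in a totally bounded group. -/
theorem AddGroupSeminorm.IsTotallyBounded.exists_nsmul_le {H ι : Type*} [AddCommGroup H] [Finite ι]
    {q : AddGroupSeminorm H} (hq : q.IsTotallyBounded) (v : ι → H) {ε : ℝ} (hε : 0 < ε) :
    ∃ N : ℕ, 2 ≤ N ∧ ∀ i, q (N • v i) ≤ ε := by
  obtain ⟨F, hF⟩ := hq (ε / 2) (half_pos hε)
  choose c hcF hc using hF
  -- Pigeonhole over even multiples, so that the difference of two of them is at least `2`.
  obtain ⟨j, k, hjk, h⟩ := Finite.exists_ne_map_eq_of_infinite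
    fun (j : ℕ) (i : ι) => (⟨c ((2 * j) • v i), hcF _⟩ : F)
  wlog hlt : j < k generalizing j k
  · exact this k j hjk.symm h.symm (by omega)
  refine ⟨2 * k - 2 * j, by omega, fun i => ?_⟩
  have h' : c ((2 * j) • v i) = c ((2 * k) • v i) := congrArg Subtype.val (congrFun h i)
  have h1 := hc ((2 * j) • v i)
  have h2 := hc ((2 * k) • v i)
  rw [← h'] at h2
  have h3 : (2 * k - 2 * j) • v i = ((2 * k) • v i - c ((2 * j) • v i)) -
      ((2 * j) • v i - c ((2 * j) • v i)) := by
    rw [sub_nsmul _ (by omega)]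
    abel
  rw [h3]
  linarith [map_sub_le_add q ((2 * k) • v i - c ((2 * j) • v i))
    ((2 * j) • v i - c ((2 * j) • v i))]

/-- A totally bounded abelian group is approximated by finite abelian groups. -/
theorem AddGroupSeminorm.IsTotallyBounded.exists_finite_approx {H : Type*} [AddCommGroup H]
    {q : AddGroupSeminorm H} (hq : q.IsTotallyBounded) {ε : ℝ} (hε : 0 < ε) :
    ∃ (A : Type) (_ : AddCommGroup A) (_ : Fintype A) (r : A → H) (s : H → A),
      (∀ a b, q (r a - r b - r (a - b)) ≤ ε) ∧ ∀ h, q (r (s h) - h) ≤ ε := by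
  classical
  obtain ⟨F, hF⟩ := hq ε hε
  choose c hcF hc using hF
  let v : Fin F.card → H := fun i => F.equivFin.symm i
  obtain ⟨N, hN, hNq⟩ := hq.exists_nsmul_le v
    (ε := ε / (F.card + 1)) (by positivity)
  have : NeZero N := ⟨by omega⟩
  have : Fact (1 < N) := ⟨hN⟩
  -- One cyclic factor per net point. A borrow in a coordinate costs only `N • v i`, which is small;
  -- `s` picks the basis vector of a nearby net point.
  refine ⟨Fin F.card → ZMod N, inferInstance, inferInstance, fun a => ∑ i, (a i).val • v i,
    fun h => Pi.single (F.equivFin ⟨c h, hcF h⟩) 1, fun a b => ?_, fun h => ?_⟩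
  · rw [← Finset.sum_sub_distrib, ← Finset.sum_sub_distrib]
    have hb : ∀ i, q ((a i).val • v i - (b i).val • v i -
        ((a - b) i).val • v i) ≤ ε / (F.card + 1) := by
      intro i
      rw [Pi.sub_apply]
      by_cases hle : (b i).val ≤ (a i).val
      · rw [ZMod.val_sub hle, sub_nsmul _ hle, ← sub_eq_add_neg, sub_self, map_zero]
        positivity
      · push Not at hle
        have hv : (a i - b i).val + (b i).val = (a i).val + N := by
          rw [← neg_sub (b i) (a i)]
          have hz : NeZero (b i - a i) := ⟨fun h => by rw [sub_eq_zero.1 h] at hle; omega⟩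
          rw [ZMod.val_neg_of_ne_zero, ZMod.val_sub hle.le]
          have := ZMod.val_lt (b i)
          omega
        have hv' := congrArg (fun k : ℕ => k • v i) hv
        simp only [add_nsmul] at hv'
        have : (a i).val • v i - (b i).val • v i - (a i - b i).val • v i =
            -(N • v i) := by
          rw [eq_neg_iff_add_eq_zero]
          rw [← sub_eq_zero] at hv'
          rw [← neg_eq_zero, ← hv']
          abel
        rw [this, map_neg_eq_map]
        exact hNq i
    refine (q.sum_le _ _).trans ((Finset.sum_le_sum fun i _ => hb i).trans ?_)
    simp only [Finset.sum_const, Finset.card_univ, Fintype.card_fin, nsmul_eq_mul]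
    rw [mul_div_assoc', div_le_iff₀ (by positivity)]
    nlinarith
  · have : ∑ i, ((Pi.single (F.equivFin ⟨c h, hcF h⟩) 1 : Fin F.card → ZMod N) i).val • v i = c h := by
      rw [Finset.sum_eq_single_of_mem (F.equivFin ⟨c h, hcF h⟩) (Finset.mem_univ _)]
      · simp [ZMod.val_one, v]
      · intro i _ hi
        simp [Pi.single_eq_of_ne hi]
    beta_reduce
    rw [this, map_sub_rev]
    exact hc h

/-- Bogolyubov's lemma is applied to a bump function on a finite model. That `m` and `δ` do not
depend on `ε` is what permits a limit. -/
theorem AddGroupSeminorm.IsTotallyBounded.exists_approx_characters {H : Type*} [AddCommGroup H]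
    {q : AddGroupSeminorm H} (hq : q.IsTotallyBounded) :
    ∃ (m : ℕ) (δ : ℝ), 0 < δ ∧ ∀ ε > 0, ∃ Ψ : Fin m → H → Circle,
      (∀ i x y, ‖(Ψ i (x + y) : ℂ) - Ψ i x * Ψ i y‖ ≤ ε) ∧
      (∀ i t, δ * ‖(Ψ i t : ℂ) - 1‖ ≤ q t + ε) ∧
      ∀ x, (∀ i, 0 ≤ (Ψ i x : ℂ).re) → q x ≤ 5 := by
  classical
  obtain ⟨F, hF⟩ := hq (1 / 2) (by norm_num)
  have hk : 0 < F.card := Finset.card_pos.2 ⟨_, (hF 0).choose_spec.1⟩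
  set k : ℝ := (F.card : ℝ) with hkdef
  have hk0 : 0 < k := Nat.cast_pos.2 hk
  -- The `k` translates of the bump `g` sum to at least `1 / 4` everywhere.
  set β : ℝ := 1 / (4 * k) with hβ
  have hβ0 : 0 < β := by positivity
  set δ := β ^ 2 / 2
  have hδ0 : 0 < δ := by positivity
  refine ⟨⌈4 / β ^ 4⌉₊, δ, hδ0, fun ε hε => ?_⟩
  -- The three bounds serve, in order, the mean of `g` and the radius `5`, the modulus of
  -- continuity, and approximate additivity.
  obtain ⟨η, hη0, hη1, hη2, hη3⟩ : ∃ η > 0, η ≤ 1 / 8 ∧ 2 * η ≤ ε ∧ 6 * η ≤ ε * δ := by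
    refine ⟨min (1 / 8) (min (ε / 2) (ε * δ / 6)), by positivity, min_le_left _ _, ?_, ?_⟩
    · linarith [min_le_right (1 / 8) (min (ε / 2) (ε * δ / 6)), min_le_left (ε / 2) (ε * δ / 6)]
    · linarith [min_le_right (1 / 8) (min (ε / 2) (ε * δ / 6)), min_le_right (ε / 2) (ε * δ / 6)]
  obtain ⟨A, _, _, r, s, hr, hs⟩ := hq.exists_finite_approx hη0
  have hA : (0 : ℝ) < Fintype.card A := by exact_mod_cast Fintype.card_pos
  let g : A → ℝ := fun a => max 0 (1 - q (r a))
  have hg0 : ∀ a, 0 ≤ g a := fun a => le_max_left _ _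
  have hg1 : ∀ a, g a ≤ 1 := fun a => max_le zero_le_one (by linarith [apply_nonneg q (r a)])
  have hrsub : ∀ a b, q (r (a - b)) ≤ q (r a - r b) + η := fun a b => by
    have := map_sub_le_add q (r a - r b) (r a - r b - r (a - b))
    rw [sub_sub_cancel] at this
    linarith [hr a b]
  have hradd : ∀ a b, q (r (a + b)) ≤ q (r a) + q (r b) + η := fun a b => by
    have h1 := hr (a + b) b
    rw [add_sub_cancel_right] at h1
    have h2 := map_add_le_add q (r (a + b) - r b - r a) (r a + r b)
    rw [show r (a + b) - r b - r a + (r a + r b) = r (a + b) by abel] at h2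
    linarith [map_add_le_add q (r a) (r b)]
  have hrs : ∀ h, q (r (s h)) ≤ q h + η := fun h => by
    have := map_add_le_add q (r (s h) - h) h
    rw [sub_add_cancel] at this
    linarith [hs h]
  have hmean : β ≤ (∑ y, g y) / Fintype.card A := by
    have h1 : ∀ y, 1 / 4 ≤ ∑ a ∈ F, g (y - s a) := by
      intro y
      obtain ⟨a, haF, ha⟩ := hF (r y)
      refine le_trans ?_ (Finset.single_le_sum (fun a _ => hg0 (y - s a)) haF)
      refine le_trans ?_ (le_max_right _ _)
      have h2 := map_sub_le_add q (r y - a) (r (s a) - a)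
      rw [sub_sub_sub_cancel_right] at h2
      linarith [hrsub y (s a), hs a]
    have h3 : (Fintype.card A : ℝ) * (1 / 4) ≤ k * ∑ y, g y := by
      calc (Fintype.card A : ℝ) * (1 / 4) = ∑ _y : A, (1 / 4 : ℝ) := by simp
        _ ≤ ∑ y, ∑ a ∈ F, g (y - s a) := Finset.sum_le_sum fun y _ => h1 y
        _ = ∑ a ∈ F, ∑ y, g (y - s a) := Finset.sum_comm
        _ = ∑ _a ∈ F, ∑ y, g y :=
            Finset.sum_congr rfl fun a _ => Equiv.sum_comp (Equiv.subRight (s a)) g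
        _ = _ := by simp [hkdef]
    rw [hβ, div_le_div_iff₀ (by positivity) hA]
    linarith
  obtain ⟨χ, hχ1, hχ2⟩ := exists_addChar_bogolyubov g hg0 hg1 hβ0 hmean (Nat.le_ceil _)
  have hχ : ∀ i t, δ * ‖χ i t - 1‖ ≤ q (r t) + η := fun i t => by
    refine hχ1 i t _ fun y => ?_
    have h1 : |g (y - t) - g y| ≤ q (r y - r (y - t)) := by
      refine (abs_max_sub_max_le_max _ _ _ _).trans ?_
      rw [sub_self, abs_zero, sub_sub_sub_cancel_left]
      refine max_le (apply_nonneg _ _) (abs_le.2 ⟨?_, ?_⟩)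
      · linarith [le_map_add_map_sub q (r (y - t)) (r y), map_sub_rev q (r (y - t)) (r y)]
      · linarith [le_map_add_map_sub q (r y) (r (y - t))]
    have h2 := map_add_le_add q (r y - r t - r (y - t)) (r t)
    rw [show r y - r t - r (y - t) + r t = r y - r (y - t) by abel] at h2
    linarith [hr y t]
  refine ⟨fun i h => AddChar.circleEquivComplex.symm (χ i) (s h), fun i x y => ?_, fun i t => ?_,
    fun x hx => ?_⟩
  · change ‖χ i (s (x + y)) - χ i (s x) * χ i (s y)‖ ≤ ε
    have h1 : χ i (s (x + y)) - χ i (s x) * χ i (s y) =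
        χ i (s x) * χ i (s y) * (χ i (s (x + y) - s x - s y) - 1) := by
      rw [mul_sub, mul_one, ← AddChar.map_add_eq_mul, ← AddChar.map_add_eq_mul]
      congr 2
      abel
    rw [h1, norm_mul, norm_mul, AddChar.norm_apply, AddChar.norm_apply, one_mul, one_mul]
    have h2 := hχ i (s (x + y) - s x - s y)
    have h3 := hrsub (s (x + y) - s x) (s y)
    have h4 : q (r (s (x + y) - s x) - r (s y)) ≤ 4 * η := by
      have e : r (s (x + y) - s x) - r (s y) =
          ((r (s (x + y)) - (x + y)) - (r (s x) - x)) - (r (s y) - y) -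
            (r (s (x + y)) - r (s x) - r (s (x + y) - s x)) := by abel
      rw [e]
      linarith [map_sub_le_add q (((r (s (x + y)) - (x + y)) - (r (s x) - x)) - (r (s y) - y))
          (r (s (x + y)) - r (s x) - r (s (x + y) - s x)),
        map_sub_le_add q ((r (s (x + y)) - (x + y)) - (r (s x) - x)) (r (s y) - y),
        map_sub_le_add q (r (s (x + y)) - (x + y)) (r (s x) - x), hs (x + y), hs x, hs y,
        hr (s (x + y)) (s x)]
    have h5 : δ * ‖χ i (s (x + y) - s x - s y) - 1‖ ≤ δ * ε := by linarith
    exact le_of_mul_le_mul_left h5 hδ0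
  · change δ * ‖χ i (s t) - 1‖ ≤ q t + ε
    linarith [hχ i (s t), hrs t]
  -- Four terms of size at most `1` and four errors `η` stay below `5`.
  · obtain ⟨a, b, c, d, ha, hb, hc, hd, he⟩ := hχ2 (s x) hx
    have hlt : ∀ a, g a ≠ 0 → q (r a) ≤ 1 := fun a ha => by
      by_contra! hcon
      exact ha (max_eq_left (by linarith))
    have h1 := hs x
    have h2 := map_sub_le_add q (r (s x)) (r (s x) - x)
    rw [sub_sub_cancel] at h2
    rw [he] at h2
    have h3 := hrsub (a - b + c) d
    have h4 := hradd (a - b) c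
    have h5 := hrsub a b
    rw [he] at h1
    linarith [map_sub_le_add q (r (a - b + c)) (r d), map_sub_le_add q (r a) (r b), hlt a ha,
      hlt b hb, hlt c hc, hlt d hd]

/-- The continuous characters of a totally bounded abelian group determine its topology. -/
theorem AddGroupSeminorm.IsTotallyBounded.exists_characters {H : Type*} [AddCommGroup H]
    {q : AddGroupSeminorm H} (hq : q.IsTotallyBounded) :
    ∃ (m : ℕ) (δ : ℝ) (χ : Fin m → AddChar H Circle), 0 < δ ∧
      (∀ i t, δ * ‖(χ i t : ℂ) - 1‖ ≤ q t) ∧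
      ∀ x, (∀ i, 0 < (χ i x : ℂ).re) → q x ≤ 5 := by
  obtain ⟨m, δ, hδ, h⟩ := hq.exists_approx_characters
  choose Ψ hadd hcont hbase using fun n : ℕ => h (1 / (n + 1)) Nat.one_div_pos_of_nat
  -- Compactness of the circle gives limits at all points along one ultrafilter.
  have hlim : ∀ i x, ∃ z : Circle, Tendsto (fun n => Ψ n i x) (hyperfilter ℕ) (𝓝 z) := by
    intro i x
    obtain ⟨z, -, hz⟩ := isCompact_univ.ultrafilter_le_nhds
      ((hyperfilter ℕ).map fun n => Ψ n i x) (by simp)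
    exact ⟨z, hz⟩
  choose L hL using hlim
  have hLc : ∀ i x, Tendsto (fun n => (Ψ n i x : ℂ)) (hyperfilter ℕ) (𝓝 (L i x : ℂ)) :=
    fun i x => (continuous_subtype_val.tendsto (L i x)).comp (hL i x)
  have hε : Tendsto (fun n : ℕ => 1 / ((n : ℝ) + 1)) (hyperfilter ℕ) (𝓝 0) :=
    tendsto_one_div_add_atTop_nhds_zero_nat.mono_left Nat.hyperfilter_le_atTop
  have hLadd : ∀ i x y, L i (x + y) = L i x * L i y := by
    intro i x y
    have h1 : ‖(L i (x + y) : ℂ) - L i x * L i y‖ ≤ 0 :=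
      le_of_tendsto_of_tendsto' ((hLc i (x + y)).sub ((hLc i x).mul (hLc i y))).norm hε
        fun n => hadd n i x y
    ext
    rw [Circle.coe_mul]
    exact sub_eq_zero.1 (norm_le_zero_iff.1 h1)
  refine ⟨m, δ, fun i => ⟨L i, ?_, hLadd i⟩, hδ, fun i t => ?_, fun x hx => ?_⟩
  · have := hLadd i 0 0
    rw [add_zero] at this
    exact left_eq_mul.1 this
  · have := le_of_tendsto_of_tendsto' (((hLc i t).sub_const 1).norm.const_mul δ)
      (hε.const_add (q t)) fun n => hcont n i t
    rwa [add_zero] at this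
  -- Strict positivity is open, so it passes from the limit back to some `n`.
  · have h1 : ∀ i, ∀ᶠ n in hyperfilter ℕ, 0 < (Ψ n i x : ℂ).re := fun i =>
      ((Complex.continuous_re.tendsto _).comp (hLc i x)).eventually_const_lt (hx i)
    obtain ⟨n, hn⟩ := (eventually_all.2 h1).exists
    exact hbase n x fun i => (hn i).le

/-! ### Continuous seminorms from neighbourhoods. -/

/-- In a commutative topological group, every neighbourhood of `0` contains a neighbourhood of `0`
defined by a continuous group seminorm. -/
theorem exists_addGroupSeminorm_of_mem_nhds {H : Type*} [AddCommGroup H] [TopologicalSpace H]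
    [IsTopologicalAddGroup H] {U : Set H} (hU : U ∈ 𝓝 (0 : H)) {R : ℝ} (hR : 0 < R) :
    ∃ q : AddGroupSeminorm H, (∀ ε > 0, ∀ᶠ x in 𝓝 0, q x ≤ ε) ∧ ∀ x, q x ≤ R → x ∈ U := by
  have hstep : ∀ W : {W : Set H // W ∈ 𝓝 (0 : H)}, ∃ V : {V : Set H // V ∈ 𝓝 (0 : H)},
      (∀ x ∈ V.1, -x ∈ V.1) ∧ ∀ x ∈ V.1, ∀ y ∈ V.1, x + y ∈ W.1 := by
    rintro ⟨W, hW⟩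
    obtain ⟨V, hV, -, hneg, hadd⟩ := exists_closed_nhds_zero_neg_eq_add_subset hW
    refine ⟨⟨V, hV⟩, fun x hx => ?_, fun x hx y hy => hadd (Set.add_mem_add hx hy)⟩
    exact hneg.le (Set.neg_mem_neg.2 hx)
  choose next hneg hadd using hstep
  -- Iterating `n + 1` times makes even `V 0` symmetric.
  let V : ℕ → {W : Set H // W ∈ 𝓝 (0 : H)} := fun n => next^[n + 1] ⟨U, hU⟩
  have hV : ∀ n, V (n + 1) = next (V n) := fun n => Function.iterate_succ_apply' ..
  have hV0 : ∀ n, (0 : H) ∈ (V n).1 := fun n => mem_of_mem_nhds (V n).2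
  have hVadd : ∀ n, ∀ x ∈ (V (n + 1)).1, ∀ y ∈ (V (n + 1)).1, x + y ∈ (V n).1 := fun n => by
    rw [hV]
    exact hadd (V n)
  have hVneg : ∀ n, ∀ x ∈ (V n).1, -x ∈ (V n).1 := by
    rintro (_ | n)
    · exact hneg _
    · rw [hV]
      exact hneg _
  have hV0U : (V 0).1 ⊆ U := fun x hx => by
    simpa using hadd ⟨U, hU⟩ x hx 0 (hV0 0)
  have hanti : Antitone fun n => (V n).1 := antitone_nat_of_succ_le fun n x hx => by
    simpa using hVadd n x hx 0 (hV0 _)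
  let B : Filter H := ⨅ n, 𝓟 (V n).1
  have hB : B.HasAntitoneBasis fun n => (V n).1 := .iInf_principal hanti
  have hnB : 𝓝 0 ≤ B := le_iInf fun n => le_principal_iff.2 (V n).2
  have hBc : B.IsCountablyGenerated := hB.isCountablyGenerated
  let S : Filter (H × H) := B.comap fun p => p.1 - p.2
  have hS : S.HasBasis (fun _ => True) fun n => {p : H × H | p.1 - p.2 ∈ (V n).1} :=
    hB.1.comap _
  let core : UniformSpace.Core H := UniformSpace.Core.mk' S
    (fun r hr x => by
      obtain ⟨n, -, hn⟩ := hS.mem_iff.1 hr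
      exact hn (by simpa using hV0 n))
    (fun r hr => by
      obtain ⟨n, -, hn⟩ := hS.mem_iff.1 hr
      refine hS.mem_iff.2 ⟨n, trivial, fun p hp => hn ?_⟩
      simpa using hVneg n _ hp)
    (fun r hr => by
      obtain ⟨n, -, hn⟩ := hS.mem_iff.1 hr
      refine ⟨{p : H × H | p.1 - p.2 ∈ (V (n + 1)).1}, hS.mem_of_mem trivial, ?_⟩
      rintro ⟨x, z⟩ ⟨y, hxy, hyz⟩
      refine hn ?_
      simpa using hVadd n _ hxy _ hyz)
  obtain ⟨d, hd0, hdsymm, hdtri, hdS⟩ : ∃ d : H → H → ℝ, (∀ x, d x x = 0) ∧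
      (∀ x y, d x y = d y x) ∧ (∀ x y z, d x z ≤ d x y + d y z) ∧
      S.HasBasis (fun ε : ℝ => 0 < ε) fun ε => {p | d p.1 p.2 < ε} := by
    let us : UniformSpace H := UniformSpace.ofCore core
    have hcg : (uniformity H).IsCountablyGenerated := inferInstanceAs S.IsCountablyGenerated
    let := UniformSpace.pseudoMetricSpace H
    exact ⟨dist, dist_self, dist_comm, dist_triangle, Metric.uniformity_basis_dist⟩
  have hdnn : ∀ x y, 0 ≤ d x y := fun x y => by
    have := hdtri x y x
    rw [hd0, hdsymm y x] at this
    linarith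
  obtain ⟨ρ, hρ, hρU⟩ := hdS.mem_iff.1 (hS.mem_of_mem (i := 0) trivial)
  set b : ℝ := min 1 ρ / 2 with hb
  have hb0 : 0 < b := by positivity
  have hbρ : b < ρ := by
    have := min_le_right 1 ρ
    have : 0 < min 1 ρ := by positivity
    linarith
  -- The pseudometric need not be translation invariant, so `q` takes a supremum over translates.
  -- The cap `2 * b` keeps it finite, yet a value at most `b` still bounds `d`. Smallness is uniform
  -- in `x` because membership in the basic entourages depends only on differences.
  let e : H → H → ℝ := fun w x => min (2 * b) (d (x + w) x)
  have hebdd : ∀ w, BddAbove (Set.range (e w)) := fun w =>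
    ⟨2 * b, by rintro _ ⟨x, rfl⟩; exact min_le_left _ _⟩
  have hle : ∀ w x, e w x ≤ ⨆ x, e w x := fun w x => le_ciSup (hebdd w) x
  let q : AddGroupSeminorm H :=
    { toFun := fun w => R / b * ⨆ x, e w x
      map_zero' := by
        have : ∀ x, e 0 x = 0 := fun x => by
          simp only [e, add_zero, hd0]
          exact min_eq_right (by positivity)
        simp [this]
      add_le' := fun v w => by
        rw [← mul_add]
        refine mul_le_mul_of_nonneg_left (ciSup_le fun x => ?_) (by positivity)
        refine le_trans ?_ (add_le_add (hle v (x + w)) (hle w x))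
        have h1 := hdtri (x + w + v) (x + w) x
        have h2 := hdnn (x + w + v) (x + w)
        have h3 := hdnn (x + w) x
        simp only [e]
        rw [add_comm v w, ← add_assoc]
        rcases le_total (2 * b) (d (x + w + v) (x + w)) with h | h
        · rw [min_eq_left h]
          exact (min_le_left _ _).trans (le_add_of_nonneg_right (le_min (by positivity) h3))
        rcases le_total (2 * b) (d (x + w) x) with h' | h'
        · rw [min_eq_left h']
          exact (min_le_left _ _).trans (le_add_of_nonneg_left (le_min (by positivity) h2))
        rw [min_eq_right h, min_eq_right h']
        exact (min_le_right _ _).trans h1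
      neg' := fun w => by
        congr 1
        refine (Equiv.addRight (-w)).iSup_congr fun x => ?_
        simp only [e, Equiv.coe_addRight, neg_add_cancel_right]
        rw [hdsymm] }
  have hq : ∀ w, q w = R / b * ⨆ x, e w x := fun w => rfl
  refine ⟨q, fun ε hε => ?_, fun x hx => hV0U ?_⟩
  · obtain ⟨n, -, hn⟩ := hS.mem_iff.1 (hdS.mem_of_mem (show 0 < ε * b / R by positivity))
    filter_upwards [(V n).2] with w hw
    rw [hq, div_mul_eq_mul_div, div_le_iff₀ hb0, ← le_div_iff₀' hR]
    refine ciSup_le fun x => (min_le_right _ _).trans (le_of_lt ?_)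
    exact hn (show (x + w, x) ∈ {p : H × H | p.1 - p.2 ∈ (V n).1} by simpa using hw)
  · have h1 : ⨆ y, e x y ≤ b := by
      rw [hq, div_mul_eq_mul_div, div_le_iff₀ hb0] at hx
      exact le_of_mul_le_mul_left hx hR
    have h2 : e x 0 ≤ b := (hle x 0).trans h1
    have h3 : d x 0 < ρ := by
      rcases min_le_iff.1 h2 with h | h
      · linarith
      · rw [zero_add] at h
        linarith
    simpa using hρU (show (x, (0 : H)) ∈ {p : H × H | d p.1 p.2 < ρ} from h3)

/-! ### Divisibility of the circle, and characters of precompact groups. -/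

theorem baer_additive_circle : Module.Baer ℤ (Additive Circle) := by
  have h : ∀ {n : ℤ}, n ≠ 0 → Function.Surjective fun a : Additive Circle => n • a := by
    intro n hn z
    refine ⟨Additive.ofMul (Circle.exp (Complex.arg z.toMul / n)), ?_⟩
    have hn' : (n : ℝ) ≠ 0 := by exact_mod_cast hn
    apply Additive.toMul.injective
    change Circle.exp (Complex.arg z.toMul / n) ^ n = z.toMul
    rw [← Circle.exp_zsmul, zsmul_eq_mul, mul_div_cancel₀ _ hn', Circle.exp_arg]
  let : DivisibleBy (Additive Circle) ℤ := divisibleByOfSMulRightSurj _ _ h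
  exact Module.Baer.of_divisible _

theorem isPrecompactTopology_of_smallPartitionFilter_le {G : Type*} [AddCommGroup G]
    {t : TopologicalSpace G} (h1 : @IsTopologicalAddGroup G t _) (h2 : @T2Space G t)
    (h : smallPartitionFilter G ≤ @nhds G t 0) : IsPrecompactTopology t :=
  ⟨h1, h2, fun _ hU => exists_finset_of_mem_smallPartitionFilter (h hU)⟩

theorem isPrecompactTopology_of_compactSpace {K : Type*} [AddCommGroup K] [t : TopologicalSpace K]
    [IsTopologicalAddGroup K] [CompactSpace K] [T2Space K] : IsPrecompactTopology t := by
  refine ⟨inferInstance, inferInstance, fun U hU => ?_⟩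
  obtain ⟨F, -, hF⟩ := isCompact_univ.elim_nhds_subcover (fun a : K => {x | x - a ∈ U})
    fun a _ => (continuous_id.sub continuous_const).continuousAt.preimage_mem_nhds (by simpa)
  exact ⟨F, fun x => by simpa using hF (Set.mem_univ x)⟩

/-- Finite partitions pull back along homomorphisms, whereas centres of translates may lie outside
the image. -/
theorem tendsto_smallPartitionFilter {G K : Type*} [AddCommGroup G] [AddCommGroup K]
    (φ : G →+ K) : Tendsto φ (smallPartitionFilter G) (smallPartitionFilter K) := by
  rintro U ⟨k, hk, c, hc⟩
  exact ⟨k, hk, c ∘ φ, fun x y h => by simpa using hc _ _ h⟩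

/-- Refining a precompact topology by a homomorphism to a compact group. -/
theorem IsPrecompactTopology.inf_induced {G K : Type*} [AddCommGroup G] [AddCommGroup K]
    [tK : TopologicalSpace K] [IsTopologicalAddGroup K] [CompactSpace K] [T2Space K]
    {t : TopologicalSpace G} (ht : IsPrecompactTopology t) (φ : G →+ K) :
    IsPrecompactTopology (t ⊓ tK.induced φ) := by
  refine isPrecompactTopology_of_smallPartitionFilter_le
    (topologicalAddGroup_inf ht.isTopologicalAddGroup (topologicalAddGroup_induced φ))
    (t2Space_antitone inf_le_left ht.t2Space) ?_
  rw [nhds_inf, nhds_induced, map_zero]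
  exact le_inf ht.smallPartitionFilter_le <| map_le_iff_le_comap.1 <|
    (tendsto_smallPartitionFilter φ).trans
      isPrecompactTopology_of_compactSpace.smallPartitionFilter_le

theorem IsPrecompactTopology.isTotallyBounded {H : Type*} [AddCommGroup H] {t : TopologicalSpace H}
    (ht : IsPrecompactTopology t) {q : AddGroupSeminorm H}
    (hq : ∀ ε > 0, ∀ᶠ x in @nhds H t 0, q x ≤ ε) : q.IsTotallyBounded := fun ε hε =>
  ht.totallyBounded _ (hq ε hε)

/-- The topology of a precompact group is determined by its continuous characters. -/
theorem IsPrecompactTopology.exists_characters {H : Type*} [AddCommGroup H] {t : TopologicalSpace H}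
    (ht : IsPrecompactTopology t) {U : Set H} (hU : U ∈ 𝓝 (0 : H)) :
    ∃ (m : ℕ) (χ : Fin m → H →+ Additive Circle), (∀ i, Continuous (χ i)) ∧
      {x | ∀ i, 0 < ((χ i x).toMul : ℂ).re} ⊆ U := by
  have := ht.isTopologicalAddGroup
  obtain ⟨q, hq, hqU⟩ := exists_addGroupSeminorm_of_mem_nhds hU (R := 5) (by norm_num)
  obtain ⟨m, δ, χ, hδ, hχ, hχU⟩ := (ht.isTotallyBounded hq).exists_characters
  refine ⟨m, fun i => (χ i).toAddMonoidHom, fun i => ?_, fun x hx => hqU x (hχU x hx)⟩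
  refine continuous_of_continuousAt_zero (χ i).toAddMonoidHom ?_
  have hq0 : Tendsto q (𝓝 0) (𝓝 0) := by
    refine Metric.tendsto_nhds.2 fun ε hε => ?_
    filter_upwards [hq (ε / 2) (half_pos hε)] with x hx
    rw [Real.dist_0_eq_abs, abs_of_nonneg (apply_nonneg q x)]
    linarith
  have h1 : Tendsto (fun x => (χ i x : ℂ)) (𝓝 0) (𝓝 ((χ i 0 : Circle) : ℂ)) := by
    rw [AddChar.map_zero_eq_one, Circle.coe_one, tendsto_iff_norm_sub_tendsto_zero]
    refine squeeze_zero (fun _ => norm_nonneg _) (g := fun x => q x / δ) (fun x => ?_) ?_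
    · rw [le_div_iff₀' hδ]
      exact hχ i x
    · simpa using hq0.div_const δ
  have h2 : Tendsto (fun x => χ i x) (𝓝 0) (𝓝 (χ i 0)) :=
    Topology.IsInducing.subtypeVal.tendsto_nhds_iff.2 h1
  exact (continuous_ofMul.tendsto _).comp h2

/-! ### Extension of characters and the proposition. -/

theorem exists_extension_tauSeq_le {G : Type*} [AddCommGroup G] {u : ℕ → G}
    (hu : IsTBSequence u) {H : AddSubgroup G} (hH : AddSubgroup.closure (Set.range u) ≤ H)
    (χ : H →+ Additive Circle)
    (hχ : Tendsto (fun n => χ (seqInSubgroup u H hH n)) atTop (𝓝 0)) :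
    ∃ ψ : G →+ Additive Circle, (∀ h : H, ψ h = χ h) ∧
      tauSeq u ≤ TopologicalSpace.induced ψ inferInstance := by
  obtain ⟨ψ, hψ⟩ := baer_additive_circle.extension_property_addMonoidHom H.subtype
    H.subtype_injective χ
  have hψ' : ∀ h : H, ψ h = χ h := fun h => DFunLike.congr_fun hψ h
  obtain ⟨t, ht, htu⟩ := hu
  -- The witness `t` supplies the Hausdorff property that the topology induced by `ψ` may lack.
  refine ⟨ψ, hψ', (sInf_le ?_).trans (inf_le_right (a := t))⟩
  refine ⟨ht.inf_induced ψ, ?_⟩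
  rw [nhds_inf, nhds_induced, map_zero]
  refine tendsto_inf.2 ⟨htu, tendsto_comap_iff.2 (hχ.congr fun n => ?_)⟩
  exact (hψ' _).symm

theorem induced_tauSeq_le {G : Type*} [AddCommGroup G] {u : ℕ → G} (hu : IsTBSequence u)
    {H : AddSubgroup G} (hH : AddSubgroup.closure (Set.range u) ≤ H) :
    TopologicalSpace.induced (Subtype.val : H → G) (tauSeq u) ≤
      tauSeq (seqInSubgroup u H hH) := by
  obtain ⟨⟨hζ, hζu⟩, -⟩ := isLeast_tauSeq (hu.seqInSubgroup H hH)
  have hτ := (isLeast_tauSeq hu).1.1.isTopologicalAddGroup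
  have hσ : @IsTopologicalAddGroup H (.induced Subtype.val (tauSeq u)) _ := by
    let _ := tauSeq u
    exact topologicalAddGroup_induced H.subtype
  rw [← continuous_id_iff_le]
  refine @continuous_of_continuousAt_zero H (TopologicalSpace.induced Subtype.val (tauSeq u)) _
    hσ H (H →+ H) _
    (tauSeq (seqInSubgroup u H hH)) hζ.isTopologicalAddGroup.toContinuousAdd _ _
    (AddMonoidHom.id H) ?_
  intro U hU
  obtain ⟨m, χ, hχ, hχU⟩ := hζ.exists_characters hU
  have hψ : ∀ i, ∃ ψ : G →+ Additive Circle, (∀ h : H, ψ h = χ i h) ∧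
      tauSeq u ≤ TopologicalSpace.induced ψ inferInstance := fun i => by
    refine exists_extension_tauSeq_le hu hH (χ i) ?_
    have := (@Continuous.tendsto _ _ (tauSeq _) _ _ (hχ i) 0).comp hζu
    rwa [map_zero] at this
  choose ψ hψ hψτ using hψ
  rw [@nhds_induced _ _ (tauSeq u)]
  refine ⟨⋂ i, {x | 0 < ((ψ i x).toMul : ℂ).re}, iInter_mem.2 fun i => ?_, fun x hx => hχU ?_⟩
  · have hcont : Tendsto (ψ i) (@nhds G (tauSeq u) 0) (𝓝 0) := by
      have := @Continuous.tendsto _ _ (tauSeq u) _ _ (continuous_iff_le_induced.2 (hψτ i)) 0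
      rwa [map_zero] at this
    have hopen : ∀ᶠ z : Additive Circle in 𝓝 0, 0 < (z.toMul : ℂ).re := by
      have hc : Continuous fun z : Additive Circle => (z.toMul : ℂ).re :=
        Complex.continuous_re.comp (continuous_subtype_val.comp continuous_toMul)
      exact (hc.tendsto 0).eventually_const_lt (by simp)
    exact hcont.eventually hopen
  · intro i
    rw [← hψ i x]
    exact Set.mem_iInter.1 hx i

/-- The restriction to a subgroup of a precompact topology is precompact. -/
theorem induced_mem_precompactTopologiesConverging {G : Type*} [AddCommGroup G] {u : ℕ → G}
    {t : TopologicalSpace G} (ht : t ∈ precompactTopologiesConverging u) {H : AddSubgroup G}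
    (hH : AddSubgroup.closure (Set.range u) ≤ H) :
    TopologicalSpace.induced (Subtype.val : H → G) t ∈
      precompactTopologiesConverging (seqInSubgroup u H hH) := by
  obtain ⟨ht, hlim⟩ := ht
  have h1 := ht.isTopologicalAddGroup
  have h2 := ht.t2Space
  refine ⟨isPrecompactTopology_of_smallPartitionFilter_le
    (inferInstanceAs (IsTopologicalAddGroup H)) (inferInstanceAs (T2Space H)) ?_, ?_⟩
  · rw [nhds_induced]
    exact map_le_iff_le_comap.1 <|
      (tendsto_smallPartitionFilter H.subtype).trans ht.smallPartitionFilter_le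
  · rw [nhds_induced]
    exact tendsto_comap_iff.2 hlim

theorem proposition1p5 {G : Type*} [AddCommGroup G] (u : ℕ → G) (hu : IsTBSequence u)
    (H : AddSubgroup G) (hH : AddSubgroup.closure (Set.range u) ≤ H) :
    IsTBSequence (seqInSubgroup u H hH) ∧
      IsFinestPrecompactExtension H (tauSeq (seqInSubgroup u H hH)) (tauSeq u) ∧
      TopologicalSpace.induced (Subtype.val : H → G) (tauSeq u) =
        tauSeq (seqInSubgroup u H hH) := by
  have hTB := hu.seqInSubgroup H hH
  have heq : TopologicalSpace.induced (Subtype.val : H → G) (tauSeq u) =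
      tauSeq (seqInSubgroup u H hH) :=
    le_antisymm (induced_tauSeq_le hu hH)
      (sInf_le (induced_mem_precompactTopologiesConverging (isLeast_tauSeq hu).1 hH))
  refine ⟨hTB, ⟨(isLeast_tauSeq hTB).1.1, (isLeast_tauSeq hu).1.1, heq, fun τ hτ hτH => ?_⟩, heq⟩
  -- Convergence of `u` to `0` in `τ` depends only on the trace of `τ` on `H`.
  refine sInf_le ⟨hτ, ?_⟩
  have hlim := (isLeast_tauSeq hTB).1.2
  rw [← hτH, nhds_induced] at hlim
  have hlim' := tendsto_comap_iff.1 hlim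
  exact hlim'
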